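/- Let $\mathbb{K}=(K,\oplus,0)$ be a commutative monoid with natural order $a\le b \iff \exists c\; a\oplus c=b$. Suppose that $\mathbb{K}$ is - positive: $a\oplus b=0$ implies $a=b=0$; - weakly absorptive: $a\oplus b=b$ for some non-zero $a,b\in K$; - not countably absorptive: there is no sequence $(a_i)_{i\in\mathbb{N}}$ in $K$ with $a_0\neq 0$ and $a_i\oplus a_{i+1}=a_{i+1}$ for all $i\in\mathbb{N}$. Fix countably infinite sets of relation names, attributes and constants, where each relation name $R$ has a finite set $\mathrm{Att}(R)$ of attributes. A tuple over $\mathrm{Att}(R)$ is a function from $\mathrm{Att}(R)$ to the constants. A $\mathbb{K}$-database consists of a finite set of relation names (its schema) and, for each $R$ in it, a finitely supported function $R^{\mathfrak D}$ from tuples over $\mathrm{Att}(R)$ to $K$. An inclusion dependency (IND) is an expression $R[A_1,\dots,A_n]\le S[B_1,\dots,B_n]$ with $n\ge 0$, $A_1,\dots,A_n\in\mathrm{Att}(R)$ pairwise distinct and $B_1,\dots,B_n\in\mathrm{Att}(S)$ pairwise distinct. It holds in $\mathfrak D$, whose schema contains $R$ and $S$, if for all constants $c_1,\dots,c_n$ $$\bigoplus_{t:\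 t(A_i)=c_i\ \forall i} R^{\mathfrak D}(t)\ \le\ \bigoplus_{t:\ t(B_i)=c_i\ \forall i} S^{\mathfrak D}(t).$$ For a finite set $\Sigma\cup\{\tau\}$ of INDs, write $\Sigma\models_{\mathbb{K}}\tau$ if every $\mathbb{K}$-database whose schema contains the relation names occurring in $\Sigma\cup\{\tau\}$ and which satisfies all INDs in $\Sigma$ also satisfies $\tau$. Write $\Sigma\vdash\tau$ if $\tau$ is derivable from $\Sigma$ by the following rules. - Reflexivity: $R[A_1,\dots,A_n]\le R[A_1,\dots,A_n]$ for pairwise distinct $A_1,\dots,A_n\in\mathrm{Att}(R)$. - Transitivity: from $R[\vec A]\le S[\vec B]$ and $S[\vec B]\le T[\vec C]$ infer $R[\vec A]\le T[\vec C]$. - Projection and permutation: from $R[A_1,\dots,A_n]\le S[B_1,\dots,B_n]$ infer $R[A_{i_1},\dots,A_{i_\ell}]\le S[B_{i_1},\dots,B_{i_\ell}]$ for distinct $i_1,\dots,i_\ell\in\{1,\dots,n\}$. Then these rules are sound and complete for the implication problem over $\mathbb{K}$: for every finite set $\Sigma\cup\{\tau\}$ of INDs, $$\Sigma\vdash\tau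 \iff \Sigma\models_{\mathbb{K}}\tau .$$ -/

import Mathlib

namespace KIND

/-! ### Commutative monoids -/

section Monoid

variable (K : Type*) [AddCommMonoid K]

/-- `K` is positive: a sum is zero only if both summands are. -/
def Positive : Prop := ∀ a b : K, a + b = 0 → a = 0 ∧ b = 0

/-- `K` is weakly absorptive: `a ⊕ b = b` for some non-zero `a`, `b`. -/
def WeaklyAbsorptive : Prop := ∃ a b : K, a ≠ 0 ∧ b ≠ 0 ∧ a + b = b

/-- `K` is countably absorptive: there is a sequence `a₀, a₁, …` with `a₀ ≠ 0` and
`aᵢ ⊕ aᵢ₊₁ = aᵢ₊₁` for all `i`. -/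
def CountablyAbsorptive : Prop :=
  ∃ a : ℕ → K, a 0 ≠ 0 ∧ ∀ i, a i + a (i + 1) = a (i + 1)

variable {K}

/-- The natural order (a preorder in general) of a commutative monoid. -/
def NatLE (a b : K) : Prop := ∃ c, a + c = b

end Monoid

/-! ### Annotated relations and databases -/

/-- Tuples over a finite set `X` of attributes. -/
abbrev Tup {Att : Type*} (Const : Type*) (X : Finset Att) : Type _ := X → Const

/-- A `K`-relation over `X`: a finitely supported function from tuples over `X` to `K`. -/
abbrev KRel {Att : Type*} (Const : Type*) (K : Type*) [AddCommMonoid K] (X : Finset Att) :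
    Type _ :=
  Tup Const X →₀ K

open Classical in
/-- The marginalisation `r[A]` of a `K`-relation along a family `A` of attributes (a sequence
`A₁, …, Aₙ` when `ι = Fin n`, or a subset of attributes when `A` is the inclusion of a subtype),
evaluated at `a`: the sum of `r t` over all tuples `t` with `t (A i) = a i` for all `i`. Only
tuples in the support contribute to this sum. -/
noncomputable def marg {Att Const K ι : Type*} [AddCommMonoid K] {X : Finset Att}
    (r : KRel Const K X) (A : ι → X) (a : ι → Const) : K :=
  ∑ t ∈ r.support with (∀ i, t (A i) = a i), r t

/-- A `K`-database, where every relation name `R` has the finite attribute set `attr R`: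
a finite schema together with a `K`-relation for each relation name in the schema. -/
structure KDatabase {Rel Att : Type*} (attr : Rel → Finset Att) (Const : Type*)
    (K : Type*) [AddCommMonoid K] where
  schema : Finset Rel
  rel : ∀ R : Rel, R ∈ schema → KRel Const K (attr R)

/-! ### Inclusion dependencies -/

/-- The inclusion dependency `R[A₁, …, Aₙ] ≤ S[B₁, …, Bₙ]`, where `A₁, …, Aₙ` are pairwise
distinct attributes of `R`, and `B₁, …, Bₙ` are pairwise distinct attributes of `S`. Arity `0`
is allowed. -/
structure IND {Rel Att : Type*} (attr : Rel → Finset Att) where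
  arity : ℕ
  lhs : Rel
  rhs : Rel
  lhsAttrs : Fin arity ↪ attr lhs
  rhsAttrs : Fin arity ↪ attr rhs

section Semantics

variable {Rel Att : Type*} {attr : Rel → Finset Att} {Const K : Type*} [AddCommMonoid K]

/-- The relation names of `σ` belong to the schema of `D`. -/
def KDatabase.Interprets (D : KDatabase attr Const K) (σ : IND attr) : Prop :=
  σ.lhs ∈ D.schema ∧ σ.rhs ∈ D.schema

/-- `D ⊨ σ`. -/
def KDatabase.Satisfies (D : KDatabase attr Const K) (σ : IND attr) : Prop :=
  ∃ (hR : σ.lhs ∈ D.schema) (hS : σ.rhs ∈ D.schema), ∀ a : Fin σ.arity → Const,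
    NatLE (marg (D.rel σ.lhs hR) σ.lhsAttrs a) (marg (D.rel σ.rhs hS) σ.rhsAttrs a)

variable (Const K) in
/-- Entailment over `K`-databases: every `K`-database, over any schema containing the relation
names that occur in `Γ` and `τ`, satisfies `τ` if it satisfies all members of `Γ`. -/
def Entails (Γ : Set (IND attr)) (τ : IND attr) : Prop :=
  ∀ D : KDatabase attr Const K, (∀ σ ∈ Γ, D.Interprets σ) → D.Interprets τ →
    (∀ σ ∈ Γ, D.Satisfies σ) → D.Satisfies τ

end Semantics

/-- Derivability by the standard rules for inclusion dependencies: reflexivity, transitivity, and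
projection and permutation. -/
inductive Derives {Rel Att : Type*} {attr : Rel → Finset Att} (Γ : Set (IND attr)) :
    IND attr → Prop
  | assumption (σ : IND attr) (h : σ ∈ Γ) : Derives Γ σ
  | reflexivity (n : ℕ) (R : Rel) (A : Fin n ↪ attr R) : Derives Γ ⟨n, R, R, A, A⟩
  | transitivity (n : ℕ) (R S T : Rel) (A : Fin n ↪ attr R) (B : Fin n ↪ attr S)
      (C : Fin n ↪ attr T) (h₁ : Derives Γ ⟨n, R, S, A, B⟩) (h₂ : Derives Γ ⟨n, S, T, B, C⟩) :
      Derives Γ ⟨n, R, T, A, C⟩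
  | projection (n l : ℕ) (R S : Rel) (A : Fin n ↪ attr R) (B : Fin n ↪ attr S)
      (i : Fin l ↪ Fin n) (h : Derives Γ ⟨n, R, S, A, B⟩) :
      Derives Γ ⟨l, R, S, i.trans A, i.trans B⟩

/-- A provability relation is sound for an entailment relation, for finite sets of assumptions. -/
def Sound {I : Type*} (prov ent : Set I → I → Prop) : Prop :=
  ∀ Γ : Set I, Γ.Finite → ∀ τ, prov Γ τ → ent Γ τ

/-- A provability relation is complete for an entailment relation, for finite sets of
assumptions. -/
def Complete {I : Type*} (prov ent : Set I → I → Prop) : Prop :=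
  ∀ Γ : Set I, Γ.Finite → ∀ τ, ent Γ τ → prov Γ τ

end KIND

/-!
Soundness is the additivity of the natural order: a marginal along a subsequence of attributes is
a finite sum of marginals along the whole sequence.

For completeness let `τ = R[A₁, …, Aₙ] ≤ S[B₁, …, Bₙ]` not be derivable from `Γ`, and let
`a ⊕ b = b` with `a`, `b` non-zero. Fix `n + 1` constants: `e (some j)` for `j < n`, and a default
value `e none`. The countermodel `countermodel` is the sum of two layers.

* The *chase layer* gives weight `a` to the tuple of `U` that has `e (some j)` at `f j` and the
  default value elsewhere, for every `f` such that `R[A] ≤ U[f]` is derivable. A point that mentions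
  all `n` constants is the projection of at most one such tuple, and derivability carries this
  tuple over along every dependency of `Γ`.
* The *background layer* is a multiple of `b`: the sum over `j` of the uniform distributions on the
  tuples whose entries are among the fixed constants other than `e (some j)`, scaled by a power of
  `n` so that all relations have the same total mass. As a mixture of product distributions, its
  marginal at a point depends on the point only, not on the relation or on the attributes
  (`marg_background`). This marginal is a positive multiple of `b` at points that miss one of the
  constants, and zero at points that mention all of them.

At a point with positive background, `b` absorbs the chase layer, so both sides of a dependency in
`Γ` agree; elsewhere only the chase layer is left, which satisfies `Γ`. So `Γ` holds. At the point
`(e (some 0), …, e (some (n - 1)))` the left side of `τ` is a positive multiple of `a`, while the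
right side is zero as `τ` is not derivable; `τ` fails since the monoid is positive.
-/

namespace KIND

/-! ### The natural order -/

section NatLE

variable {K : Type*} [AddCommMonoid K]

theorem NatLE.refl (a : K) : NatLE a a := ⟨0, add_zero a⟩

theorem NatLE.trans {a b c : K} (h₁ : NatLE a b) (h₂ : NatLE b c) : NatLE a c := by
  obtain ⟨x, rfl⟩ := h₁
  obtain ⟨y, rfl⟩ := h₂
  exact ⟨x + y, (add_assoc a x y).symm⟩

theorem NatLE.sum {ι : Type*} (s : Finset ι) {f g : ι → K} (h : ∀ i ∈ s, NatLE (f i) (g i)) :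
    NatLE (∑ i ∈ s, f i) (∑ i ∈ s, g i) := by
  have h' : ∀ i, ∃ c, i ∈ s → f i + c = g i := fun i => by
    by_cases hi : i ∈ s
    · obtain ⟨c, hc⟩ := h i hi
      exact ⟨c, fun _ => hc⟩
    · exact ⟨0, fun hi' => absurd hi' hi⟩
  choose c hc using h'
  exact ⟨∑ i ∈ s, c i, by rw [← Finset.sum_add_distrib]; exact Finset.sum_congr rfl hc⟩

theorem NatLE.nsmul_of_le (a : K) {k l : ℕ} (h : k ≤ l) : NatLE (k • a) (l • a) :=
  ⟨(l - k) • a, by rw [← add_nsmul, Nat.add_sub_cancel' h]⟩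

/-- If `b` absorbs `a`, then every positive multiple of `b` absorbs every multiple of `a`. -/
theorem nsmul_add_nsmul_of_absorbs {a b : K} (h : a + b = b) (k : ℕ) {m : ℕ} (hm : m ≠ 0) :
    k • a + m • b = m • b := by
  obtain ⟨m, rfl⟩ := Nat.exists_eq_succ_of_ne_zero hm
  have hk : k • a + b = b := by
    induction k with
    | zero => simp
    | succ k ih => rw [succ_nsmul, add_assoc, h, ih]
  rw [Nat.succ_eq_add_one, succ_nsmul, add_left_comm, hk]

theorem Positive.eq_zero_of_nsmul_add_eq_zero (hpos : Positive K) {a c : K} {k : ℕ} (hk : k ≠ 0)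
    (h : k • a + c = 0) : a = 0 := by
  obtain ⟨k, rfl⟩ := Nat.exists_eq_succ_of_ne_zero hk
  have := (hpos _ _ h).1
  rw [Nat.succ_eq_add_one, succ_nsmul] at this
  exact (hpos _ _ this).2

end NatLE

/-! ### Marginals -/

section Marg

variable {Att Const K ι κ : Type*} [AddCommMonoid K] {X : Finset Att}

open Classical in
theorem marg_eq_sum (r : KRel Const K X) (A : ι → X) (c : ι → Const) :
    marg r A c = r.sum fun t k => if (fun i => t (A i)) = c then k else 0 := by
  simp only [marg, Finsupp.sum, Finset.sum_filter, funext_iff]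

theorem marg_add (r s : KRel Const K X) (A : ι → X) (c : ι → Const) :
    marg (r + s) A c = marg r A c + marg s A c := by
  classical
  simp only [marg_eq_sum]
  exact Finsupp.sum_add_index' (fun t => by simp) (fun t k l => by split_ifs <;> simp)

theorem marg_sum (s : Finset κ) (r : κ → KRel Const K X) (A : ι → X) (c : ι → Const) :
    marg (∑ x ∈ s, r x) A c = ∑ x ∈ s, marg (r x) A c := by
  classical
  induction s using Finset.induction_on with
  | empty => simp [marg]
  | insert x s hx ih => rw [Finset.sum_insert hx, Finset.sum_insert hx, marg_add, ih]

open Classical in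
theorem marg_single (t : Tup Const X) (k : K) (A : ι → X) (c : ι → Const) :
    marg (Finsupp.single t k) A c = if (fun i => t (A i)) = c then k else 0 := by
  rw [marg_eq_sum]
  exact Finsupp.sum_single_index (by simp)

/-- A family of tuples that all carry the weight `k` has as its marginal the number of tuples over
the given point, times `k`. -/
theorem marg_sum_single (s : Finset κ) (t : κ → Tup Const X) (k : K) (A : ι → X)
    (c : ι → Const) [DecidablePred fun x => (fun i => t x (A i)) = c] :
    marg (∑ x ∈ s, Finsupp.single (t x) k) A c =
      (s.filter fun x => (fun i => t x (A i)) = c).card • k := by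
  classical
  rw [marg_sum, ← Finset.sum_const, Finset.sum_filter]
  refine Finset.sum_congr rfl fun x _ => ?_
  rw [marg_single]
  congr

open Classical in
/-- Marginalising in two steps: first along `A`, then along `i`. -/
theorem marg_comp (r : KRel Const K X) (A : κ → X) (i : ι → κ) (c : ι → Const)
    (F : Finset (κ → Const)) (hF : ∀ t ∈ r.support, (fun x => t (A x)) ∈ F) :
    marg r (fun x => A (i x)) c = ∑ d ∈ F with (fun x => d (i x)) = c, marg r A d := by
  simp only [marg_eq_sum, Finsupp.sum]
  rw [Finset.sum_comm]
  refine Finset.sum_congr rfl fun t ht => ?_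
  rw [Finset.sum_ite_eq]
  simp [hF t ht]

end Marg

/-! ### Soundness -/

section Soundness

variable {Rel Att : Type*} {attr : Rel → Finset Att} {Const K : Type*} [AddCommMonoid K]

theorem KDatabase.Satisfies.projection {D : KDatabase attr Const K} {n l : ℕ} {R S : Rel}
    {A : Fin n ↪ attr R} {B : Fin n ↪ attr S} (i : Fin l ↪ Fin n)
    (h : D.Satisfies ⟨n, R, S, A, B⟩) : D.Satisfies ⟨l, R, S, i.trans A, i.trans B⟩ := by
  classical
  obtain ⟨hR, hS, h⟩ := h
  refine ⟨hR, hS, fun c => ?_⟩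
  let F : Finset (Fin n → Const) :=
    (D.rel R hR).support.image (fun t x => t (A x)) ∪
      (D.rel S hS).support.image (fun t x => t (B x))
  have h₁ := marg_comp (D.rel R hR) A i c F fun t ht =>
    Finset.mem_union_left _ (Finset.mem_image_of_mem _ ht)
  have h₂ := marg_comp (D.rel S hS) B i c F fun t ht =>
    Finset.mem_union_right _ (Finset.mem_image_of_mem _ ht)
  change NatLE (marg (D.rel R hR) (fun x => A (i x)) c) (marg (D.rel S hS) (fun x => B (i x)) c)
  rw [h₁, h₂]
  exact NatLE.sum _ fun d _ => h d

/-- A derivation may pass through relation names outside the schema only if its conclusion starts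
at such a name; hence the assumption on the left side. -/
theorem Derives.satisfies {Γ : Set (IND attr)} {σ : IND attr} (h : Derives Γ σ)
    {D : KDatabase attr Const K} (hD : ∀ ρ ∈ Γ, D.Satisfies ρ) (hσ : σ.lhs ∈ D.schema) :
    D.Satisfies σ := by
  induction h with
  | assumption σ h => exact hD σ h
  | reflexivity n R A => exact ⟨hσ, hσ, fun c => NatLE.refl _⟩
  | transitivity n R S T A B C _ _ ih₁ ih₂ =>
    obtain ⟨hR, hS, h₁⟩ := ih₁ hσ
    obtain ⟨_, hT, h₂⟩ := ih₂ hS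
    exact ⟨hR, hT, fun c => (h₁ c).trans (h₂ c)⟩
  | projection n l R S A B i _ ih => exact (ih hσ).projection i

end Soundness

/-! ### The chase layer -/

section Chase

variable {Rel Att : Type*} {attr : Rel → Finset Att} {Const K : Type*} [AddCommMonoid K]

/-- The tuple with value `e (some j)` at the attribute `f j`, and `e none` at all attributes
outside the range of `f`. -/
noncomputable def chaseTuple {X : Finset Att} {n : ℕ} (e : Option (Fin n) ↪ Const)
    (f : Fin n ↪ X) : Tup Const X :=
  fun x => e (Function.partialInv f x)

theorem chaseTuple_eq_iff {X : Finset Att} {n : ℕ} (e : Option (Fin n) ↪ Const)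
    (f : Fin n ↪ X) (x : X) (j : Fin n) : chaseTuple e f x = e (some j) ↔ f j = x := by
  rw [chaseTuple, e.injective.eq_iff]
  exact f.injective.isPartialInv j x

/-- Transporting the range of a chase tuple along two families of attributes preserves its
projection. -/
theorem chaseTuple_trans {X Y : Finset Att} {n l : ℕ} (e : Option (Fin n) ↪ Const)
    (i : Fin n ↪ Fin l) (C : Fin l ↪ X) (D : Fin l ↪ Y) (x : Fin l) :
    chaseTuple e (i.trans C) (C x) = chaseTuple e (i.trans D) (D x) := by
  unfold chaseTuple
  congr 1
  ext j
  rw [(i.trans C).injective.isPartialInv j (C x),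
    (i.trans D).injective.isPartialInv j (D x)]
  simp

open Classical in
/-- The families `f` of attributes of `U` for which `R[A] ≤ U[f]` is derivable. -/
noncomputable def derivable (Γ : Set (IND attr)) {n : ℕ} {R : Rel} (A : Fin n ↪ attr R)
    (U : Rel) : Finset (Fin n ↪ attr U) :=
  {f | Derives Γ ⟨n, R, U, A, f⟩}

theorem mem_derivable {Γ : Set (IND attr)} {n : ℕ} {R : Rel} {A : Fin n ↪ attr R} {U : Rel}
    {f : Fin n ↪ attr U} : f ∈ derivable Γ A U ↔ Derives Γ ⟨n, R, U, A, f⟩ := by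
  simp [derivable]

/-- The chase layer: weight `a` at the tuples forced by a tuple over `R` with the values
`e (some j)` at `A j`. -/
noncomputable def chase (Γ : Set (IND attr)) {n : ℕ} {R : Rel} (A : Fin n ↪ attr R)
    (e : Option (Fin n) ↪ Const) (a : K) (U : Rel) : KRel Const K (attr U) :=
  ∑ f ∈ derivable Γ A U, Finsupp.single (chaseTuple e f) a

open Classical in
/-- The number of chase tuples of `U` whose projection along `C` is `c`. -/
noncomputable def chaseCount (Γ : Set (IND attr)) {n : ℕ} {R : Rel} (A : Fin n ↪ attr R)
    (e : Option (Fin n) ↪ Const) (U : Rel) {l : ℕ} (C : Fin l ↪ attr U) (c : Fin l → Const) : ℕ :=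
  ((derivable Γ A U).filter fun f => (fun i => chaseTuple e f (C i)) = c).card

theorem marg_chase (Γ : Set (IND attr)) {n : ℕ} {R : Rel} (A : Fin n ↪ attr R)
    (e : Option (Fin n) ↪ Const) (a : K) (U : Rel) {l : ℕ} (C : Fin l ↪ attr U)
    (c : Fin l → Const) :
    marg (chase Γ A e a U) C c = chaseCount Γ A e U C c • a := by
  classical
  rw [chaseCount, chase, marg_sum_single]

/-- Over points that mention all constants `e (some j)`, the chase layer satisfies every derivable
dependency: there is at most one chase tuple on the left, and its transport lies on the right. -/
theorem chaseCount_le {Γ : Set (IND attr)} {n : ℕ} {R : Rel} (A : Fin n ↪ attr R)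
    (e : Option (Fin n) ↪ Const) {U V : Rel} {l : ℕ} {C : Fin l ↪ attr U} {D : Fin l ↪ attr V}
    (h : Derives Γ ⟨l, U, V, C, D⟩) (c : Fin l → Const) (hc : ∀ j, ∃ i, c i = e (some j)) :
    chaseCount Γ A e U C c ≤ chaseCount Γ A e V D c := by
  classical
  choose i hi using hc
  have hf : ∀ f : Fin n ↪ attr U, (fun x => chaseTuple e f (C x)) = c → ∀ j, f j = C (i j) := by
    rintro f rfl j
    exact (chaseTuple_eq_iff e f _ j).1 (hi j)
  rcases Nat.eq_zero_or_pos (chaseCount Γ A e U C c) with h0 | h0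
  · omega
  refine le_trans (b := 1) (Finset.card_le_one.2 fun f hf₁ g hg₁ => ?_) ?_
  · ext j : 1
    rw [hf f (Finset.mem_filter.1 hf₁).2 j, hf g (Finset.mem_filter.1 hg₁).2 j]
  obtain ⟨f, hf₁⟩ := Finset.card_pos.1 h0
  obtain ⟨hf₁, hf₂⟩ := Finset.mem_filter.1 hf₁
  have hinj : Function.Injective i := fun j k hjk =>
    f.injective (by rw [hf f hf₂, hf f hf₂, hjk])
  let i' : Fin n ↪ Fin l := ⟨i, hinj⟩
  obtain rfl : f = i'.trans C := by
    ext j : 1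
    exact hf f hf₂ j
  refine Finset.card_pos.2 ⟨i'.trans D, Finset.mem_filter.2 ⟨mem_derivable.2 ?_, ?_⟩⟩
  · exact .transitivity _ _ _ _ _ _ _ (mem_derivable.1 hf₁) (.projection _ _ _ _ _ _ i' h)
  · rw [← hf₂]
    funext x
    exact (chaseTuple_trans e i' C D x).symm

end Chase

/-! ### The background layer -/

section Background

variable {Att Const K : Type*} [AddCommMonoid K]

open Classical in
/-- The background layer over `X`: for each `j`, every tuple over `X` whose entries are constants
`e x` with `x ≠ some j` gets weight `n ^ (M - |X|) • b`. There are `n ^ |X|` such tuples, so that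
the total mass does not depend on `X`, provided that `|X| ≤ M`. -/
noncomputable def background {n : ℕ} (e : Option (Fin n) ↪ Const) (b : K) (M : ℕ)
    (X : Finset Att) : KRel Const K X :=
  ∑ j : Fin n, ∑ g : X → {x : Option (Fin n) // x ≠ some j},
    Finsupp.single (fun x => e (g x)) (n ^ (M - X.card) • b)

theorem card_extensions {X Y ι : Type*} [Fintype X] [DecidableEq X] [Fintype Y]
    [Fintype ι] (A : ι ↪ X) (g₀ : ι → Y)
    [DecidablePred fun g : X → Y => (fun i => g (A i)) = g₀] :
    (Finset.univ.filter fun g : X → Y => (fun i => g (A i)) = g₀).card =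
      Fintype.card Y ^ (Fintype.card X - Fintype.card ι) := by
  classical
  have h : (Finset.univ.filter fun g : X → Y => (fun i => g (A i)) = g₀) =
      Fintype.piFinset fun x => if h : ∃ i, A i = x then {g₀ h.choose} else Finset.univ := by
    ext g
    simp only [Finset.mem_filter, Finset.mem_univ, true_and, Fintype.mem_piFinset]
    constructor
    · rintro rfl x
      split_ifs with h
      · exact Finset.mem_singleton.2 (congrArg g h.choose_spec.symm)
      · exact Finset.mem_univ _
    · intro h
      funext i
      have hi : ∃ i', A i' = A i := ⟨i, rfl⟩
      have := h (A i)
      rw [dif_pos hi, Finset.mem_singleton] at this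
      rw [this, A.injective hi.choose_spec]
  have hX : (Finset.univ.filter fun x : X => ∃ i, A i = x) = Finset.univ.map A := by
    ext x
    simp
  have hc : ∀ x, (if h : ∃ i, A i = x then {g₀ h.choose} else Finset.univ : Finset Y).card =
      if ∃ i, A i = x then 1 else Fintype.card Y := by
    intro x
    split_ifs
    · exact Finset.card_singleton _
    · rfl
  rw [h, Fintype.card_piFinset, Finset.prod_congr rfl fun x _ => hc x, Finset.prod_ite,
    Finset.prod_const_one, one_mul, Finset.prod_const, Finset.filter_not, hX,
    Finset.card_sdiff_of_subset (Finset.subset_univ _), Finset.card_map, Finset.card_univ,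
    Finset.card_univ]

/-- The point `c` has all its entries among the constants `e x` with `x ≠ some j`. -/
def Misses {n : ℕ} (e : Option (Fin n) ↪ Const) {l : ℕ} (c : Fin l → Const) (j : Fin n) : Prop :=
  ∀ i, ∃ x, x ≠ some j ∧ e x = c i

open Classical in
/-- The multiplicity of `b` in the background marginal at the point `c`. -/
noncomputable def backgroundCount {n : ℕ} (e : Option (Fin n) ↪ Const) (M : ℕ) {l : ℕ}
    (c : Fin l → Const) : ℕ :=
  ∑ j : Fin n, if Misses e c j then n ^ (M - l) else 0

theorem backgroundCount_ne_zero {n : ℕ} {e : Option (Fin n) ↪ Const} {M l : ℕ}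
    {c : Fin l → Const} {j : Fin n} (h : Misses e c j) : backgroundCount e M c ≠ 0 := by
  classical
  have hn : 0 < n := j.pos
  refine (lt_of_lt_of_le (pow_pos hn (M - l)) ?_).ne'
  refine le_trans ?_ (Finset.single_le_sum (fun _ _ => Nat.zero_le _) (Finset.mem_univ j))
  rw [if_pos h]

theorem backgroundCount_eq_zero {n : ℕ} {e : Option (Fin n) ↪ Const} {M l : ℕ}
    {c : Fin l → Const} (h : ∀ j, ¬ Misses e c j) : backgroundCount e M c = 0 :=
  Finset.sum_eq_zero fun j _ => if_neg (h j)

/-- The marginals of the background layer depend on the point only. -/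
theorem marg_background {n : ℕ} (e : Option (Fin n) ↪ Const) (b : K) {M : ℕ} {X : Finset Att}
    (hM : X.card ≤ M) {l : ℕ} (C : Fin l ↪ X) (c : Fin l → Const) :
    marg (background e b M X) C c = backgroundCount e M c • b := by
  classical
  rw [background, marg_sum, backgroundCount, ← Finset.sum_nsmul_assoc]
  refine Finset.sum_congr rfl fun j _ => ?_
  rw [marg_sum_single]
  have hl : l ≤ X.card := by simpa using Fintype.card_le_of_embedding C
  split_ifs with hj
  · choose x hx hxc using hj
    have h : (Finset.univ.filter fun g : X → {x : Option (Fin n) // x ≠ some j} =>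
        (fun i => e (g (C i))) = c) =
        Finset.univ.filter fun g : X → {x : Option (Fin n) // x ≠ some j} =>
          (fun i => g (C i)) = fun i => ⟨x i, hx i⟩ := by
      ext g
      simp only [Finset.mem_filter, Finset.mem_univ, true_and, funext_iff, Subtype.ext_iff,
        ← hxc, e.injective.eq_iff]
    have hY : Fintype.card {x : Option (Fin n) // x ≠ some j} = n := by
      simp [Fintype.card_subtype_compl]
    rw [h, card_extensions C, hY, ← mul_nsmul', ← pow_add, Fintype.card_coe, Fintype.card_fin]
    congr 2
    omega
  · rw [zero_nsmul, Finset.filter_eq_empty_iff.2, Finset.card_empty, zero_nsmul]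
    rintro g - rfl
    exact hj fun i => ⟨g (C i), (g (C i)).2, rfl⟩

end Background

/-! ### The countermodel -/

section Countermodel

variable {Rel Att : Type*} {attr : Rel → Finset Att} {Const K : Type*} [AddCommMonoid K]

/-- The sum of the chase layer and the background layer, over the given schema. The scale of the
background is the largest number of attributes of a relation name in the schema. -/
noncomputable def countermodel (s : Finset Rel) (Γ : Set (IND attr)) {n : ℕ} {R : Rel}
    (A : Fin n ↪ attr R) (e : Option (Fin n) ↪ Const) (a b : K) : KDatabase attr Const K where
  schema := s
  rel U _ := chase Γ A e a U + background e b (s.sup fun U => (attr U).card) (attr U)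

theorem marg_countermodel {s : Finset Rel} (Γ : Set (IND attr)) {n : ℕ} {R : Rel}
    (A : Fin n ↪ attr R) (e : Option (Fin n) ↪ Const) (a b : K) {U : Rel} (hU : U ∈ s) {l : ℕ}
    (C : Fin l ↪ attr U) (c : Fin l → Const) :
    marg ((countermodel s Γ A e a b).rel U hU) C c =
      chaseCount Γ A e U C c • a + backgroundCount e (s.sup fun U => (attr U).card) c • b := by
  rw [← marg_chase, ← marg_background e b (X := attr U)
    (Finset.le_sup (f := fun U => (attr U).card) hU) C]
  exact marg_add _ _ _ _

theorem countermodel_satisfies {s : Finset Rel} {Γ : Set (IND attr)} {n : ℕ} {R : Rel}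
    (A : Fin n ↪ attr R) (e : Option (Fin n) ↪ Const) {a b : K} (hab : a + b = b)
    {σ : IND attr} (hσ : Derives Γ σ) (hs : σ.lhs ∈ s ∧ σ.rhs ∈ s) :
    (countermodel s Γ A e a b).Satisfies σ := by
  refine ⟨hs.1, hs.2, fun c => ?_⟩
  rw [marg_countermodel, marg_countermodel]
  by_cases hm : backgroundCount e (s.sup fun U => (attr U).card) c = 0
  · rw [hm, zero_nsmul, add_zero, add_zero]
    by_cases hr : ∀ i, ∃ x, e x = c i
    · refine NatLE.nsmul_of_le a (chaseCount_le A e hσ c fun j => ?_)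
      by_contra! hj
      refine backgroundCount_ne_zero (j := j) (fun i => ?_) hm
      obtain ⟨x, hx⟩ := hr i
      exact ⟨x, fun h => hj i (by rw [← hx, h]), hx⟩
    · -- Chase tuples have all their entries in the range of `e`.
      have h0 : chaseCount Γ A e σ.lhs σ.lhsAttrs c = 0 := by
        classical
        refine Finset.card_eq_zero.2 (Finset.filter_eq_empty_iff.2 ?_)
        rintro f - rfl
        exact hr fun i => ⟨_, rfl⟩
      exact NatLE.nsmul_of_le a (h0 ▸ Nat.zero_le _)
  · rw [nsmul_add_nsmul_of_absorbs hab _ hm, nsmul_add_nsmul_of_absorbs hab _ hm]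
    exact NatLE.refl _

theorem not_countermodel_satisfies (hpos : Positive K) {s : Finset Rel} {Γ : Set (IND attr)}
    {n : ℕ} {R S : Rel} {A : Fin n ↪ attr R} {B : Fin n ↪ attr S} (e : Option (Fin n) ↪ Const)
    {a : K} (b : K) (ha : a ≠ 0) (hτ : ¬ Derives Γ ⟨n, R, S, A, B⟩) :
    ¬ (countermodel s Γ A e a b).Satisfies ⟨n, R, S, A, B⟩ := by
  classical
  rintro ⟨hR : R ∈ s, hS : S ∈ s, h⟩
  have hm : backgroundCount e (s.sup fun U => (attr U).card) (fun j => e (some j)) = 0 :=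
    backgroundCount_eq_zero fun j hj => by
      obtain ⟨x, hx, hx'⟩ := hj j
      exact hx (e.injective hx')
  obtain ⟨d, hd⟩ := h fun j => e (some j)
  dsimp only at hd
  rw [marg_countermodel Γ A e a b hR A, marg_countermodel Γ A e a b hS B, hm, zero_nsmul,
    add_zero, add_zero] at hd
  have hB : chaseCount Γ A e S B (fun j => e (some j)) = 0 := by
    refine Finset.card_eq_zero.2 (Finset.filter_eq_empty_iff.2 fun f hf hfB => hτ ?_)
    obtain rfl : f = B := by
      ext j : 1
      exact (chaseTuple_eq_iff e f _ j).1 (congrFun hfB j)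
    exact mem_derivable.1 hf
  have hA : chaseCount Γ A e R A (fun j => e (some j)) ≠ 0 :=
    (Finset.card_pos.2 ⟨A, Finset.mem_filter.2 ⟨mem_derivable.2 (.reflexivity _ _ _),
      funext fun j => (chaseTuple_eq_iff e A _ j).2 rfl⟩⟩).ne'
  rw [hB, zero_nsmul] at hd
  exact ha (hpos.eq_zero_of_nsmul_add_eq_zero hA hd)

theorem derives_of_entails [Infinite Const] (hpos : Positive K) (hwa : WeaklyAbsorptive K)
    {Γ : Set (IND attr)} (hΓ : Γ.Finite) {τ : IND attr} (h : Entails Const K Γ τ) :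
    Derives Γ τ := by
  classical
  by_contra hτ
  obtain ⟨a, b, ha, -, hab⟩ := hwa
  obtain ⟨n, R, S, A, B⟩ := τ
  let e : Option (Fin n) ↪ Const :=
    (Fintype.equivFin (Option (Fin n))).toEmbedding.trans
      (Fin.valEmbedding.trans (Infinite.natEmbedding Const))
  let s : Finset Rel := {R, S} ∪ (hΓ.toFinset.image IND.lhs ∪ hΓ.toFinset.image IND.rhs)
  have hs : ∀ σ ∈ Γ, σ.lhs ∈ s ∧ σ.rhs ∈ s := fun σ hσ => by
    have hσ' := hΓ.mem_toFinset.2 hσ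
    exact ⟨Finset.mem_union_right _ (Finset.mem_union_left _ (Finset.mem_image_of_mem _ hσ')),
      Finset.mem_union_right _ (Finset.mem_union_right _ (Finset.mem_image_of_mem _ hσ'))⟩
  refine not_countermodel_satisfies hpos (s := s) e b ha hτ (h _ hs ?_ fun σ hσ =>
    countermodel_satisfies A e hab (.assumption σ hσ) (hs σ hσ))
  exact ⟨Finset.mem_union_left _ (by simp), Finset.mem_union_left _ (by simp)⟩

end Countermodel

end KIND

theorem mainTheorem5
    {K : Type*} [AddCommMonoid K]
    (hpos : KIND.Positive K) (hwa : KIND.WeaklyAbsorptive K)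
    (hca : ¬ KIND.CountablyAbsorptive K)
    {Rel Att Const : Type*} [Countable Rel] [Infinite Rel] [Countable Att] [Infinite Att]
    [Countable Const] [Infinite Const] (attr : Rel → Finset Att) :
    KIND.Sound (KIND.Derives (attr := attr)) (KIND.Entails (attr := attr) Const K) ∧
      KIND.Complete (KIND.Derives (attr := attr)) (KIND.Entails (attr := attr) Const K) :=
  ⟨fun _ _ _ h _ _ hτ hD => h.satisfies hD hτ.1,
    fun _ hΓ _ h => KIND.derives_of_entails hpos hwa hΓ h⟩
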